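/- **Proposition ($A_1$ partial DWPF).** Let $0\le k\le L$ be integers, $\gamma\in\mathbb C$, $u=(u_1,\dots,u_k)\in\mathbb C^k$ with pairwise distinct entries, $m=(m_1,\dots,m_L)\in\mathbb C^L$. For a subset $I=\{I_1<\dots<I_k\}\subset\{1,\dots,L\}$ let $$\widehat\psi_I(u;m)=\sum_{\sigma\in\mathfrak S_k}\omega_I(u_{\sigma(1)},\dots,u_{\sigma(k)};m),$$ $$\omega_I(u;m)=\prod_{a=1}^k\Big(\prod_{i=1}^{I_a-1}\big(u_a-m_i-\tfrac\gamma2\big)\prod_{i=I_a+1}^{L}\big(u_a-m_i+\tfrac\gamma2\big)\Big)\prod_{1\le a<b\le k}\frac{u_a-u_b-\gamma}{u_a-u_b}$$ be the normalized orbifold defect of the $A_1$ quiver. (When $u_a-u_b+\gamma\neq0$ for all $a\ne b$, it equals $$(-1)^{kL+\sum_a I_a}\prod_{a<b}\big(\gamma^2-(u_a-u_b)^2\big)\sum_{\sigma\in\mathfrak S_k}f_I(u_{\sigma(1)},\dots,u_{\sigma(k)}),$$ $$f_I(u)=\frac{\prod_{a}\big(\prod_{i<I_a}(u_a-m_i-\frac\gamma2)\prod_{i>I_a}(-u_a+m_i-\frac\gamma2)\big)}{\prod_{a<b}(u_b-u_a)(u_a-u_b+\gamma)}\,.)$$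 Put $$\widehat{\mathcal Z}_k(u;m)=\sum_{I\subset\{1,\dots,L\},\ |I|=k}\widehat\psi_I(u;m).$$ For $x\in\mathbb C^k$, $y\in\mathbb C^L$ let $Z^{\mathrm{pDW}}_{k,L}(x;y)$ be the partial domain wall partition function of the rational $\mathfrak{su}(2)$ six-vertex model: the sum, over all colourings of the bonds of a lattice of $k$ horizontal lines (with rapidities $x_1,\dots,x_k$ from bottom to top) and $L$ vertical lines (with inhomogeneities $y_1,\dots,y_L$ from left to right) by the colours $1,2$ with colour $1$ on all left boundary bonds, colour $2$ on all right and all lower boundary bonds, and arbitrary colours on the top boundary bonds, of the product of all vertex weights. A vertex on the lines of $x_a$ and $y_i$ whose left, bottom, right and top bonds have colours $l,b,r,t$ has weight $x_a-y_i+\gamma$ if $l=b=r=t$; $x_a-y_i$ if $l=r\ne b=t$; $\gamma$ if $l=t\neq b=r$; and $0$ otherwise. (For $\gamma=1$ these are the weights $x-y+1$, $x-y$, $1$.) Then: 1. $Z^{\mathrm{pDW}}_{k,L}\big(u_1-\tfrac\gamma2,\dots,u_k-\tfrac\gamma2;\,m\big)=\gamma^k\,\widehat{\mathcal Z}_k(u;m)$.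 In particular, for $\gamma=1$ the two partition functions are equal. 2. If the $m_i$ are pairwise distinct and $u_a-m_i\pm\frac\gamma2\ne0$ for all $a,i$, then $$\widehat{\mathcal Z}_k(u;m)=\frac{\prod_{a=1}^k\prod_{i=1}^L\big(u_a-m_i-\frac\gamma2\big)\big(u_a-m_i+\frac\gamma2\big)}{\prod_{1\le a<b\le k}(u_b-u_a)\prod_{1\le i<j\le L}(m_i-m_j)}\,\det F,$$ where $F$ is the $L\times L$ matrix with $F_{rj}=\dfrac1{(u_r-m_j-\frac\gamma2)(u_r-m_j+\frac\gamma2)}$ for $r\le k$ and $F_{rj}=m_j^{L-r}$ for $k<r\le L$ (so the last $L-k$ rows are $m_j^{L-k-1},\dots,m_j^0$). 3. If $\gamma\neq0$ and $u_a-m_i+\frac\gamma2\ne0$ for all $a,i$, then $$\widehat{\mathcal Z}_k(u;m)=\frac1{(-\gamma)^k}\,\frac{\prod_{a=1}^k\prod_{i=1}^L\big(u_a-m_i+\frac\gamma2\big)}{\prod_{1\le a<b\le k}(u_b-u_a)}\,\det\Big(u_a^{b-1}\prod_{i=1}^L\frac{u_a-m_i-\frac\gamma2}{u_a-m_i+\frac\gamma2}-(u_a-\gamma)^{b-1}\Big)_{a,b=1}^{k}.$$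 -/

import Mathlib

namespace PartialDWPF

noncomputable section

/-- Symmetrization `Sym_u f (u) = ∑_{σ ∈ S_k} f (u_{σ(1)}, …, u_{σ(k)})`. -/
def symmetrize {k : ℕ} (f : (Fin k → ℂ) → ℂ) (u : Fin k → ℂ) : ℂ :=
  ∑ σ : Equiv.Perm (Fin k), f (fun a => u (σ a))

/-- The unnormalized orbifold defect `ψ_I(u; m)` of the `A₁` quiver.  The indices of `Fin k` and
`Fin L` are zero-based, so the position usually written `I_a` is `(I a : ℕ) + 1`. -/
def defectPsi (γ : ℂ) {k L : ℕ} (I : Fin k → Fin L) (u : Fin k → ℂ) (m : Fin L → ℂ) : ℂ :=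
  symmetrize (fun u =>
    (∏ a, ((∏ i ∈ Finset.Iio (I a), (u a - m i - γ / 2)) *
        ∏ i ∈ Finset.Ioi (I a), (-u a + m i - γ / 2))) /
      ∏ a, ∏ b ∈ Finset.Ioi a, ((u b - u a) * (u a - u b + γ))) u

/-- The normalizing factor `(-1)^{kL + ∑ I_a} ∏_{a<b} (γ² - (u_a - u_b)²)`. -/
def defectNorm (γ : ℂ) {k L : ℕ} (I : Fin k → Fin L) (u : Fin k → ℂ) : ℂ :=
  (-1) ^ (k * L + ∑ a, ((I a : ℕ) + 1)) *
    ∏ a, ∏ b ∈ Finset.Ioi a, (γ ^ 2 - (u a - u b) ^ 2)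

/-- The summand `ω_I(u; m)` of the normalized defect. -/
def defectSummand (γ : ℂ) {k L : ℕ} (I : Fin k → Fin L) (u : Fin k → ℂ) (m : Fin L → ℂ) : ℂ :=
  (∏ a, ((∏ i ∈ Finset.Iio (I a), (u a - m i - γ / 2)) *
      ∏ i ∈ Finset.Ioi (I a), (u a - m i + γ / 2))) *
    ∏ a, ∏ b ∈ Finset.Ioi a, ((u a - u b - γ) / (u a - u b))

/-- The normalized orbifold defect `ψ̂_I(u; m)`, i.e. the normalizing factor times `ψ_I(u; m)`
after cancellation of the common factors; see `orbifoldDefect_eq_norm_mul_psi`. -/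
def orbifoldDefect (γ : ℂ) {k L : ℕ} (I : Fin k → Fin L) (u : Fin k → ℂ) (m : Fin L → ℂ) : ℂ :=
  symmetrize (fun u => defectSummand γ I u m) u

theorem prod_pairs_perm {k : ℕ} (g : Fin k → Fin k → ℂ) (hg : ∀ a b, g a b = g b a)
    (σ : Equiv.Perm (Fin k)) :
    ∏ a, ∏ b ∈ Finset.Ioi a, g (σ a) (σ b) = ∏ a, ∏ b ∈ Finset.Ioi a, g a b := by
  let f : Fin k → Fin k → ℂ := fun i j => if i < j then 1 else if j < i then -1 else 0
  have hf : ∀ i j, f i j = -f j i := by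
    intro i j
    rcases lt_trichotomy i j with h | h | h
    · simp [f, h, h.not_gt]
    · simp [f, h]
    · simp [f, h, h.not_gt]
  have h1 := σ.prod_Ioi_comp_eq_sign_mul_prod hf
  have h2 := σ.prod_Ioi_comp_eq_sign_mul_prod (f := fun i j => g i j * f i j)
    (fun i j => by rw [hg i j, hf i j]; ring)
  have h3 : ∏ i, ∏ j ∈ Finset.Ioi i, f i j = 1 :=
    Finset.prod_eq_one fun i _ => Finset.prod_eq_one fun j hj => by
      simp [f, Finset.mem_Ioi.1 hj]
  simp only [Finset.prod_mul_distrib, h1, h3, mul_one] at h2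
  have hs : ((Equiv.Perm.sign σ : ℤ) : ℂ) ≠ 0 := by
    exact_mod_cast (Equiv.Perm.sign σ).ne_zero
  exact mul_right_cancel₀ hs (h2.trans (mul_comm _ _))

/-- The normalized defect is the normalizing factor times the unnormalized defect. -/
theorem orbifoldDefect_eq_norm_mul_psi (γ : ℂ) {k L : ℕ} (I : Fin k → Fin L) (u : Fin k → ℂ)
    (m : Fin L → ℂ) (hu : Function.Injective u) (hγ : ∀ a b, a ≠ b → u a - u b + γ ≠ 0) :
    orbifoldDefect γ I u m = defectNorm γ I u * defectPsi γ I u m := by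
  unfold orbifoldDefect defectPsi symmetrize
  rw [Finset.mul_sum]
  refine Finset.sum_congr rfl fun σ _ => ?_
  have h1 : defectNorm γ I u = defectNorm γ I (fun a => u (σ a)) := by
    unfold defectNorm
    rw [prod_pairs_perm (fun a b => γ ^ 2 - (u a - u b) ^ 2) (fun a b => by ring) σ]
  rw [h1]
  unfold defectSummand defectNorm
  have h2 : ∀ a b : Fin k, b ∈ Finset.Ioi a →
      (u (σ a) - u (σ b) - γ) / (u (σ a) - u (σ b)) =
      (γ ^ 2 - (u (σ a) - u (σ b)) ^ 2) /
        ((u (σ b) - u (σ a)) * (u (σ a) - u (σ b) + γ)) := by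
    intro a b hab
    have hab' : σ a ≠ σ b := σ.injective.ne (Finset.mem_Ioi.1 hab).ne
    have e1 : u (σ a) - u (σ b) ≠ 0 := sub_ne_zero.2 (hu.ne hab')
    have e2 : u (σ b) - u (σ a) ≠ 0 := sub_ne_zero.2 (hu.ne hab'.symm)
    have e3 := hγ _ _ hab'
    rw [div_eq_div_iff e1 (mul_ne_zero e2 e3)]
    ring
  have h3 : ∀ a : Fin k, ∏ i ∈ Finset.Ioi (I a), (-u (σ a) + m i - γ / 2) =
      (-1) ^ (L + ((I a : ℕ) + 1)) * ∏ i ∈ Finset.Ioi (I a), (u (σ a) - m i + γ / 2) := by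
    intro a
    have hL : L + ((I a : ℕ) + 1) = (L - 1 - (I a : ℕ)) + 2 * ((I a : ℕ) + 1) := by
      have := (I a).isLt
      omega
    rw [hL, pow_add, pow_mul]
    have hc : L - 1 - (I a : ℕ) = (Finset.Ioi (I a)).card := by simp
    rw [hc, ← Finset.prod_const, neg_one_sq, one_pow, mul_one, ← Finset.prod_mul_distrib]
    exact Finset.prod_congr rfl fun i _ => by ring
  have h4 : (∏ a : Fin k, ((-1 : ℂ)) ^ (L + ((I a : ℕ) + 1))) =
      (-1) ^ (k * L + ∑ a, ((I a : ℕ) + 1)) := by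
    rw [Finset.prod_pow_eq_pow_sum, Finset.sum_add_distrib]
    simp
  beta_reduce
  rw [Finset.prod_congr rfl fun a _ => Finset.prod_congr rfl fun b hb => h2 a b hb]
  simp only [h3, Finset.prod_div_distrib, Finset.prod_mul_distrib, h4]
  rcases neg_one_pow_eq_or ℂ (k * L + ∑ a, ((I a : ℕ) + 1)) with h | h <;> rw [h] <;> ring

/-- The partition function `Ẑ_k(u; m) = ∑_{I ⊂ {1, …, L}, |I| = k} ψ̂_I(u; m)`, where the elements
of `I` are listed in increasing order. -/
def defectSum (γ : ℂ) {k L : ℕ} (u : Fin k → ℂ) (m : Fin L → ℂ) : ℂ :=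
  ∑ I : {I : Finset (Fin L) // I.card = k}, orbifoldDefect γ (I.1.orderEmbOfFin I.2) u m

/-- The rational six-vertex weights `a = x - y + γ`, `b = x - y`, `c = γ` of a vertex where a
horizontal line of rapidity `x` meets a vertical line of inhomogeneity `y`.  The colours on the
left, bottom, right and top bonds are `l`, `b`, `r`, `t`; colour enters at the left and the bottom
and leaves at the right and the top.  At `γ = 1` these are `x - y + 1`, `x - y` and `1`. -/
def vertexWeight (γ x y : ℂ) (l b r t : Fin 2) : ℂ :=
  if l = r ∧ b = t then (if l = b then x - y + γ else x - y)
  else if l = t ∧ b = r then γ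
  else 0

/-- Colourings of the bonds of the lattice with `k` horizontal lines (numbered from the bottom) and
`L` vertical lines (numbered from the left): `σ.1 a i` is the colour of the `i`-th bond of the
`a`-th horizontal line, `σ.2 a i` that of the `a`-th bond of the `i`-th vertical line.  The element
`0 : Fin 2` stands for colour 1, and `1 : Fin 2` stands for colour 2. -/
abbrev Colouring (k L : ℕ) : Type :=
  (Fin k → Fin (L + 1) → Fin 2) × (Fin (k + 1) → Fin L → Fin 2)

/-- Partial domain wall boundary conditions: colour 1 on the left boundary, colour 2 on the right
and lower boundaries, and no condition on the top boundary. -/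
def IsPartialDomainWall {k L : ℕ} (σ : Colouring k L) : Prop :=
  (∀ a, σ.1 a 0 = 0) ∧ (∀ a, σ.1 a (Fin.last L) = 1) ∧ (∀ i, σ.2 0 i = 1)

open Classical in
/-- The partial domain wall partition function of the rational six-vertex model: the sum of the
products of the vertex weights over all colourings with partial domain wall boundary conditions. -/
def sixVertexPDWPF (γ : ℂ) {k L : ℕ} (x : Fin k → ℂ) (y : Fin L → ℂ) : ℂ :=
  ∑ σ : Colouring k L with IsPartialDomainWall σ,
    ∏ a, ∏ i, vertexWeight γ (x a) (y i)
      (σ.1 a i.castSucc) (σ.2 a.castSucc i) (σ.1 a i.succ) (σ.2 a.succ i)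

/-- The `L × L` matrix whose first `k` rows are `1 / ((u_a - m_j - γ/2) (u_a - m_j + γ/2))` and
whose remaining rows are `m_j^{L-k-1}, …, m_j^0`. -/
def fodaWheelerMatrix (γ : ℂ) {k L : ℕ} (u : Fin k → ℂ) (m : Fin L → ℂ) :
    Matrix (Fin L) (Fin L) ℂ :=
  Matrix.of fun r j =>
    if h : (r : ℕ) < k then
      1 / ((u ⟨r, h⟩ - m j - γ / 2) * (u ⟨r, h⟩ - m j + γ / 2))
    else m j ^ (L - 1 - (r : ℕ))

/-- The `k × k` matrix `u_a^{b-1} ∏_i (u_a - m_i - γ/2)/(u_a - m_i + γ/2) - (u_a - γ)^{b-1}`, with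
`b - 1` the zero-based column index. -/
def kostovMatrix (γ : ℂ) {k L : ℕ} (u : Fin k → ℂ) (m : Fin L → ℂ) :
    Matrix (Fin k) (Fin k) ℂ :=
  Matrix.of fun a b =>
    u a ^ (b : ℕ) * ∏ i, (u a - m i - γ / 2) / (u a - m i + γ / 2) - (u a - γ) ^ (b : ℕ)

end

end PartialDWPF

namespace PartialDWPF

noncomputable section

open Finset Kronecker

/-! All quantities are compared with one expression, `partitionSum`, taken with d(z) = ∏ (z - m_i -
γ/2) and α(z) = ∏ (z - m_i + γ/2): a sum over the subsets T of the rapidities.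

Defects: `partitionSum_column` strips off one column and reproduces the recursion of the defect sum
according to whether I contains the first site; hence `pow_mul_defectSum`.

Determinants: a determinant whose rows are α(w)(w+c)^b - d(w)(w+c+γ)^b expands by multilinearity
into Vandermonde determinants with the nodes in T shifted by γ (`det_eq_partitionSum`). The offset c
= -γ gives the k × k formula; c = -γ/2 gives the L × L one, after a Lagrange matrix has cleared the
monomial rows.

Six-vertex model: in the algebraic Bethe ansatz each row is an operator B(x) = T_01(x) acting on the
pseudo-vacuum of colour 2. The covector v summing over the free top boundary satisfies v(A + B) = αv
with A = T_00, so B can be traded for A, and A moved to the vacuum. The resulting recursion is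
`partitionSum_insert` (`map_creation`). -/

/-! ### Subset sums of exchange factors and their recursions -/

/-- The exchange factor `(a - b - γ) / (a - b)` of two rapidities. -/
def exch (γ a b : ℂ) : ℂ := (a - b - γ) / (a - b)

/-- The polynomial ∏ (X + x + γ) - ∏ (X + x) has degree below #S, so Lagrange interpolation at the
nodes -a, a ∈ S, where the second product vanishes, recovers its value at -m. -/
theorem prod_sub_add_eq (γ m : ℂ) (S : Finset ℂ) :
    ∏ x ∈ S, (x - m + γ) =
      ∏ x ∈ S, (x - m) + γ * ∑ a ∈ S, ∏ b ∈ S.erase a, ((b - m) * exch γ a b) := by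
  open Polynomial in
  let p : ℂ[X] := ∏ x ∈ S, (X + C (x + γ)) - ∏ x ∈ S, (X + C x)
  have hinj : Set.InjOn (fun x : ℂ => -x) S := neg_injective.injOn
  have hmon : ∀ g : ℂ → ℂ, (∏ x ∈ S, (X + C (g x)) : ℂ[X]).Monic := fun g =>
    monic_prod_of_monic _ _ fun i _ => monic_X_add_C _
  have hdegp : ∀ g : ℂ → ℂ, (∏ x ∈ S, (X + C (g x)) : ℂ[X]).degree = #S := by
    intro g
    rw [degree_prod]
    simp
  have hdeg : p.degree < #S := by
    rw [← hdegp fun x => x + γ]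
    refine degree_sub_lt_left ?_ (hmon _).ne_zero ?_
    · rw [hdegp (fun x => x + γ), hdegp (fun x => x)]
    · rw [(hmon fun x => x + γ).leadingCoeff, (hmon fun x => x).leadingCoeff]
  have h := congrArg (Polynomial.eval (-m)) (Lagrange.eq_interpolate hinj hdeg)
  rw [Lagrange.interpolate_apply, eval_finsetSum] at h
  have hp : ∀ t, p.eval t = ∏ x ∈ S, (t + (x + γ)) - ∏ x ∈ S, (t + x) := by
    intro t
    simp [p, eval_prod]
  rw [← sub_eq_iff_eq_add']
  have e1 : p.eval (-m) = ∏ x ∈ S, (x - m + γ) - ∏ x ∈ S, (x - m) := by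
    rw [hp]
    congr 1 <;> exact prod_congr rfl fun x _ => by ring
  rw [← e1, h, mul_sum]
  refine sum_congr rfl fun a ha => ?_
  rw [eval_mul, eval_C, hp, prod_eq_zero ha (f := fun x => -a + x) (by ring), sub_zero,
    ← mul_prod_erase _ _ ha, Lagrange.basis, eval_prod]
  rw [show -a + (a + γ) = γ by ring, mul_assoc, ← prod_mul_distrib]
  congr 1
  refine prod_congr rfl fun b hb => ?_
  have hab : a - b ≠ 0 := sub_ne_zero.2 (ne_of_mem_erase hb).symm
  have hab' : -a - -b ≠ 0 := by
    contrapose! hab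
    linear_combination -hab
  simp only [Lagrange.basisDivisor, eval_mul, eval_C, eval_sub, eval_X, exch]
  field_simp
  ring

/-- `∑_{T ⊆ S} ∏_{j ∈ T} (-d j) ∏_{i ∈ S \ T} α i ∏_{i ∈ S \ T, j ∈ T} (i - j - γ) / (i - j)`. -/
def partitionSum (γ : ℂ) (d α : ℂ → ℂ) (S : Finset ℂ) : ℂ :=
  ∑ T ∈ S.powerset, (∏ j ∈ T, -d j) * (∏ i ∈ S \ T, α i) * ∏ i ∈ S \ T, ∏ j ∈ T, exch γ i j

@[simp]
theorem partitionSum_empty (γ : ℂ) (d α : ℂ → ℂ) : partitionSum γ d α ∅ = 1 := by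
  simp [partitionSum]

theorem sum_powerset_erase_comm {S : Finset ℂ} (F : ℂ → Finset ℂ → ℂ) :
    ∑ j ∈ S, ∑ T ∈ (S.erase j).powerset, F j T = ∑ T ∈ S.powerset, ∑ j ∈ T, F j (T.erase j) := by
  rw [sum_sigma', sum_sigma']
  refine sum_bij' (fun p _ => ⟨insert p.1 p.2, p.1⟩) (fun p _ => ⟨p.2, p.1.erase p.2⟩) ?_ ?_ ?_ ?_ ?_
  · rintro ⟨j, T⟩ h
    simp only [mem_sigma, mem_powerset] at h ⊢
    exact ⟨insert_subset h.1 (h.2.trans (erase_subset _ _)), mem_insert_self _ _⟩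
  · rintro ⟨T, j⟩ h
    simp only [mem_sigma, mem_powerset] at h ⊢
    exact ⟨h.1 h.2, erase_subset_erase _ h.1⟩
  · rintro ⟨j, T⟩ h
    simp only [mem_sigma, mem_powerset] at h
    have : j ∉ T := fun hj => by simpa using h.2 hj
    simp [this]
  · rintro ⟨T, j⟩ h
    simp only [mem_sigma, mem_powerset] at h
    simp [insert_erase h.2]
  · rintro ⟨j, T⟩ h
    simp only [mem_sigma, mem_powerset] at h
    have : j ∉ T := fun hj => by simpa using h.2 hj
    simp [this]

theorem sum_powerset_erase_comm' {S : Finset ℂ} (F : ℂ → Finset ℂ → ℂ) :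
    ∑ a ∈ S, ∑ T ∈ (S.erase a).powerset, F a T = ∑ T ∈ S.powerset, ∑ a ∈ S \ T, F a T := by
  refine sum_comm' fun a T => ?_
  simp only [mem_powerset, mem_sdiff, subset_erase]
  tauto

/-- For each T, expand ∏ (x - m + γ) over S \ T by `prod_sub_add_eq`. The term of a ∈ S \ T removes
a from the set; its exchange factors with T complete the product over S \ {a}. -/
theorem partitionSum_column (γ m : ℂ) (d α : ℂ → ℂ) (S : Finset ℂ) :
    partitionSum γ (fun x => (x - m) * d x) (fun x => (x - m + γ) * α x) S =
      (∏ x ∈ S, (x - m)) * partitionSum γ d α S +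
        γ * ∑ a ∈ S, (∏ b ∈ S.erase a, ((b - m) * exch γ a b)) * α a *
          partitionSum γ d α (S.erase a) := by
  simp only [partitionSum, mul_sum]
  rw [sum_powerset_erase_comm', ← sum_add_distrib]
  refine sum_congr rfl fun T hT => ?_
  have hT := mem_powerset.1 hT
  simp only [← mul_neg]
  have key : ∀ X Y P Q R s : ℂ, X * Y * ((P + γ * s) * Q) * R =
      P * X * (Y * Q * R) + s * (γ * X * Y * Q * R) := fun X Y P Q R s => by ring
  rw [prod_mul_distrib, prod_mul_distrib, prod_sub_add_eq, ← prod_sdiff hT, key, sum_mul]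
  congr 1
  · refine sum_congr rfl fun a ha => ?_
    have ha' := mem_sdiff.1 ha
    have hd : S.erase a \ T = (S \ T).erase a := by
      ext x
      simp only [mem_sdiff, mem_erase]
      tauto
    have hT' : T ⊆ S.erase a := subset_erase.2 ⟨hT, ha'.2⟩
    rw [← prod_sdiff hT', hd, prod_mul_distrib (s := T), ← mul_prod_erase (S \ T) α ha,
      ← mul_prod_erase (S \ T) (fun i => ∏ j ∈ T, exch γ i j) ha]
    ring

theorem exch_neg (γ a b : ℂ) : exch (-γ) a b = exch γ b a := by
  rw [exch, exch, ← neg_div_neg_eq]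
  congr 1 <;> ring

/-- This and `prod_exch_right` are `prod_sub_add_eq` with shift -γ, taken at y - γ and at y
respectively, and divided by ∏ (x - y). -/
theorem prod_exch_left (γ y : ℂ) (T : Finset ℂ) (hy : y ∉ T) :
    ∏ j ∈ T, exch γ y j =
      1 + ∑ j ∈ T, γ / (j - y) * ((∏ i ∈ T.erase j, exch γ i j) * ∏ i ∈ T.erase j, exch γ y i) := by
  have h := prod_sub_add_eq (-γ) (y - γ) T
  have hne : ∀ x ∈ T, x - y ≠ 0 := fun x hx => sub_ne_zero.2 fun h => hy (h ▸ hx)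
  have hne' : ∏ x ∈ T, (x - y) ≠ 0 := prod_ne_zero_iff.2 hne
  have hnum : ∀ U ⊆ T, (∏ x ∈ U, (x - y)) * ∏ x ∈ U, exch γ y x = ∏ x ∈ U, (x - (y - γ)) := by
    intro U hU
    rw [← prod_mul_distrib]
    refine prod_congr rfl fun x hx => ?_
    have := hne x (hU hx)
    have h' : y - x ≠ 0 := by
      contrapose! this
      linear_combination -this
    rw [exch]
    field_simp
    ring
  rw [prod_congr rfl fun x _ => show x - (y - γ) + -γ = x - y by ring, ← hnum T subset_rfl] at h
  refine mul_left_cancel₀ hne' ?_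
  rw [mul_add, mul_one, mul_sum]
  nth_rewrite 2 [h]
  rw [mul_sum, add_assoc, ← sum_add_distrib, sum_eq_zero, add_zero]
  intro a ha
  rw [prod_mul_distrib, ← hnum _ (erase_subset _ _), ← mul_prod_erase _ _ ha]
  simp only [exch_neg]
  have := hne a ha
  field_simp
  ring

theorem prod_exch_right (γ y : ℂ) (T : Finset ℂ) (hy : y ∉ T) :
    ∏ j ∈ T, exch γ j y + ∑ j ∈ T, γ / (j - y) * ∏ i ∈ T.erase j, exch γ i j = 1 := by
  have h := prod_sub_add_eq (-γ) y T
  have hne : ∀ x ∈ T, x - y ≠ 0 := fun x hx => sub_ne_zero.2 fun h => hy (h ▸ hx)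
  have hne' : ∏ x ∈ T, (x - y) ≠ 0 := prod_ne_zero_iff.2 hne
  have hnum : (∏ x ∈ T, (x - y)) * ∏ x ∈ T, exch γ x y = ∏ x ∈ T, (x - y + -γ) := by
    rw [← prod_mul_distrib]
    refine prod_congr rfl fun x hx => ?_
    have := hne x hx
    rw [exch]
    field_simp
    ring
  refine mul_left_cancel₀ hne' ?_
  rw [mul_add, hnum, h, mul_one, mul_sum, mul_sum, add_assoc, ← sum_add_distrib, sum_eq_zero,
    add_zero]
  intro a ha
  rw [prod_mul_distrib, ← mul_prod_erase _ _ ha]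
  simp only [exch_neg]
  have := hne a ha
  field_simp
  ring

theorem partitionSum_insert' (γ y : ℂ) (d α : ℂ → ℂ) (S : Finset ℂ) (hy : y ∉ S) :
    partitionSum γ d α (insert y S) =
      α y * ∑ T ∈ S.powerset, (∏ j ∈ T, -d j) * (∏ i ∈ S \ T, α i) *
          ((∏ i ∈ S \ T, ∏ j ∈ T, exch γ i j) * ∏ j ∈ T, exch γ y j) +
        -d y * ∑ T ∈ S.powerset, (∏ j ∈ T, -d j) * (∏ i ∈ S \ T, α i) *
          ((∏ i ∈ S \ T, ∏ j ∈ T, exch γ i j) * ∏ i ∈ S \ T, exch γ i y) := by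
  rw [partitionSum, sum_powerset_insert hy, mul_sum, mul_sum]
  congr 1
  · refine sum_congr rfl fun T hT => ?_
    have hyT : y ∉ T := fun h => hy (mem_powerset.1 hT h)
    have hyS : y ∉ S \ T := fun h => hy (mem_sdiff.1 h).1
    rw [insert_sdiff_of_notMem _ hyT, prod_insert hyS, prod_insert hyS]
    ring
  · refine sum_congr rfl fun T hT => ?_
    have hyT : y ∉ T := fun h => hy (mem_powerset.1 hT h)
    have hs : insert y S \ insert y T = S \ T := by
      rw [insert_sdiff_insert, sdiff_insert_of_notMem hy]
    rw [hs, prod_insert hyT, prod_congr rfl fun i _ => prod_insert hyT, prod_mul_distrib]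
    ring

/-- The recursion produced by the Bethe ansatz; every set on the right has fewer elements. With j
absorbed into T, both sides are sums over T ⊆ S: the coefficients of α y match by `prod_exch_left`,
those of d y by `prod_exch_right`. -/
theorem partitionSum_insert (γ y : ℂ) (d α : ℂ → ℂ) (S : Finset ℂ) (hy : y ∉ S) :
    partitionSum γ d α (insert y S) =
      (α y - d y * ∏ x ∈ S, exch γ x y) * partitionSum γ d α S -
        ∑ j ∈ S, γ / (j - y) * d j * (∏ i ∈ S.erase j, exch γ i j) *
          partitionSum γ d α (insert y (S.erase j)) := by
  rw [sum_congr rfl fun j _ => by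
    rw [partitionSum_insert' γ y d α (S.erase j) fun h => hy (mem_of_mem_erase h)]]
  rw [partitionSum_insert' γ y d α S hy, partitionSum]
  simp only [mul_add, sum_add_distrib, mul_sum]
  rw [sum_powerset_erase_comm, sum_powerset_erase_comm, sub_add_eq_sub_sub, sub_eq_add_neg,
    sub_eq_add_neg, ← sum_neg_distrib, ← sum_neg_distrib, ← sum_add_distrib, ← sum_add_distrib,
    ← sum_add_distrib]
  refine sum_congr rfl fun T hT => ?_
  have hT := mem_powerset.1 hT
  have hyT : y ∉ T := fun h => hy (hT h)
  have hsd : ∀ j ∈ T, S.erase j \ T.erase j = S \ T := by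
    intro j hj
    ext x
    simp only [mem_sdiff, mem_erase]
    constructor
    · tauto
    · rintro ⟨h1, h2⟩
      have : x ≠ j := fun h => h2 (h ▸ hj)
      tauto
  have hS : ∀ j ∈ T, ∏ i ∈ S.erase j, exch γ i j =
      (∏ i ∈ S \ T, exch γ i j) * ∏ i ∈ T.erase j, exch γ i j := by
    intro j hj
    rw [← prod_sdiff (erase_subset_erase j hT), hsd j hj]
  have hcross : ∀ j ∈ T, ∏ i ∈ S \ T, ∏ j ∈ T, exch γ i j =
      (∏ i ∈ S \ T, exch γ i j) * ∏ i ∈ S \ T, ∏ j ∈ T.erase j, exch γ i j := by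
    intro j hj
    rw [← prod_mul_distrib]
    exact prod_congr rfl fun i _ => (mul_prod_erase _ _ hj).symm
  have hd : ∀ j ∈ T, ∏ j ∈ T, -d j = -d j * ∏ j ∈ T.erase j, -d j := fun j hj =>
    (mul_prod_erase _ _ hj).symm
  have e1 : ∀ j ∈ T, γ / (j - y) * d j * (∏ i ∈ S.erase j, exch γ i j) *
      (α y * ((∏ j ∈ T.erase j, -d j) * (∏ i ∈ S.erase j \ T.erase j, α i) *
        ((∏ i ∈ S.erase j \ T.erase j, ∏ j ∈ T.erase j, exch γ i j) *
          ∏ j ∈ T.erase j, exch γ y j))) =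
      -(α y * ((∏ j ∈ T, -d j) * (∏ i ∈ S \ T, α i) * ∏ i ∈ S \ T, ∏ j ∈ T, exch γ i j)) *
        (γ / (j - y) * ((∏ i ∈ T.erase j, exch γ i j) * ∏ i ∈ T.erase j, exch γ y i)) := by
    intro j hj
    rw [hsd j hj, hS j hj, hcross j hj, hd j hj]
    ring
  have e2 : ∀ j ∈ T, γ / (j - y) * d j * (∏ i ∈ S.erase j, exch γ i j) *
      (-d y * ((∏ j ∈ T.erase j, -d j) * (∏ i ∈ S.erase j \ T.erase j, α i) *
        ((∏ i ∈ S.erase j \ T.erase j, ∏ j ∈ T.erase j, exch γ i j) *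
          ∏ i ∈ S.erase j \ T.erase j, exch γ i y))) =
      (d y * ((∏ j ∈ T, -d j) * (∏ i ∈ S \ T, α i) * ∏ i ∈ S \ T, ∏ j ∈ T, exch γ i j)) *
        (∏ i ∈ S \ T, exch γ i y) * (γ / (j - y) * ∏ i ∈ T.erase j, exch γ i j) := by
    intro j hj
    rw [hsd j hj, hS j hj, hcross j hj, hd j hj]
    ring
  rw [sum_congr rfl e1, sum_congr rfl e2, ← mul_sum, ← mul_sum, prod_exch_left γ y T hyT,
    ← prod_sdiff hT (f := fun i => exch γ i y)]
  linear_combination (-d y * ((∏ j ∈ T, -d j) * (∏ i ∈ S \ T, α i) *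
    ∏ i ∈ S \ T, ∏ j ∈ T, exch γ i j)) * (∏ i ∈ S \ T, exch γ i y) *
      (-prod_exch_right γ y T hyT)

/-- The lattice without columns: no site is available for a rapidity. In the recursion every term
vanishes by induction, except that a singleton leaves α - d = 0. -/
theorem partitionSum_one (γ : ℂ) (S : Finset ℂ) (hS : S.Nonempty) :
    partitionSum γ (fun _ => 1) (fun _ => 1) S = 0 := by
  induction h : #S using Nat.strong_induction_on generalizing S with
  | _ n ih =>
    obtain ⟨y, hy⟩ := hS
    rw [← insert_erase hy, partitionSum_insert _ _ _ _ _ (notMem_erase y S)]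
    have hlt : #(S.erase y) < n := h ▸ card_erase_lt_of_mem hy
    rcases (S.erase y).eq_empty_or_nonempty with he | hne
    · simp [he]
    · rw [ih _ hlt _ hne rfl, mul_zero, zero_sub, neg_eq_zero]
      refine sum_eq_zero fun j hj => ?_
      rw [ih _ ?_ _ (insert_nonempty y _) rfl, mul_zero]
      exact (card_insert_le _ _).trans_lt <|
        (Nat.succ_le_of_lt (card_erase_lt_of_mem hj)).trans_lt hlt

/-! ### The defect sum as a subset sum -/

open Classical in
theorem defectSum_eq_sum_strictMono (γ : ℂ) {k L : ℕ} (u : Fin k → ℂ) (m : Fin L → ℂ) :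
    defectSum γ u m = ∑ I : Fin k → Fin L with StrictMono I, orbifoldDefect γ I u m := by
  rw [defectSum]
  refine sum_bij (fun I _ => I.1.orderEmbOfFin I.2) ?_ ?_ ?_ ?_
  · intro I _
    simp [(I.1.orderEmbOfFin I.2).strictMono]
  · intro I _ J _ h
    have h' := congrArg Set.range h
    rw [range_orderEmbOfFin, range_orderEmbOfFin, coe_inj] at h'
    exact Subtype.ext h'
  · intro I hI
    have hI := (mem_filter.1 hI).2
    have hc : #(univ.image I) = k := by
      rw [card_image_of_injective _ hI.injective, card_univ, Fintype.card_fin]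
    exact ⟨⟨univ.image I, hc⟩, mem_univ _,
      (orderEmbOfFin_unique hc (fun x => mem_image_of_mem _ (mem_univ x)) hI).symm⟩
  · intros
    rfl

open Classical in
theorem sum_strictMono_succ {k L : ℕ} (F : (Fin (k + 1) → Fin (L + 1)) → ℂ) :
    ∑ I : Fin (k + 1) → Fin (L + 1) with StrictMono I, F I =
      (∑ I : Fin (k + 1) → Fin L with StrictMono I, F fun a => (I a).succ) +
        ∑ I : Fin k → Fin L with StrictMono I, F (Fin.cons 0 fun a => (I a).succ) := by
  rw [← sum_filter_add_sum_filter_not _ (fun I => I 0 ≠ 0)]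
  congr 1
  · symm
    refine sum_bij (fun I _ a => (I a).succ) ?_ ?_ ?_ fun _ _ => rfl
    · intro I hI
      simp only [mem_filter, mem_univ, true_and] at hI ⊢
      exact ⟨fun a b hab => Fin.succ_lt_succ_iff.2 (hI hab), Fin.succ_ne_zero _⟩
    · intro I _ J _ h
      funext a
      exact Fin.succ_injective _ (congrFun h a)
    · intro I hI
      simp only [mem_filter, mem_univ, true_and] at hI
      have h0 : ∀ a, I a ≠ 0 := fun a =>
        ((Fin.pos_of_ne_zero hI.2).trans_le (hI.1.monotone (Fin.zero_le a))).ne'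
      refine ⟨fun a => (I a).pred (h0 a), ?_, by simp⟩
      simp only [mem_filter, mem_univ, true_and]
      exact fun a b hab => Fin.pred_lt_pred_iff.2 (hI.1 hab)
  · symm
    refine sum_bij (fun I _ => Fin.cons 0 fun a => (I a).succ) ?_ ?_ ?_ fun _ _ => rfl
    · intro I hI
      simp only [mem_filter, mem_univ, true_and] at hI ⊢
      refine ⟨?_, by simp⟩
      intro a b hab
      induction b using Fin.cases with
      | zero => exact absurd hab (Fin.not_lt_zero _)
      | succ b =>
        induction a using Fin.cases with
        | zero => simp
        | succ a => simpa using hI (Fin.succ_lt_succ_iff.1 hab)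
    · intro I _ J _ h
      funext a
      simpa using congrFun h a.succ
    · intro I hI
      simp only [mem_filter, mem_univ, true_and, not_not] at hI
      have h0 : ∀ a : Fin k, I a.succ ≠ 0 := fun a => by
        rw [← hI.2]
        exact (hI.1 (Fin.succ_pos a)).ne'
      refine ⟨fun a => (I a.succ).pred (h0 a), ?_, ?_⟩
      · simp only [mem_filter, mem_univ, true_and]
        exact fun a b hab => Fin.pred_lt_pred_iff.2 (hI.1 (Fin.succ_lt_succ_iff.2 hab))
      · funext a
        induction a using Fin.cases with
        | zero => simp [hI.2]
        | succ a => simp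

theorem prod_Iio_succ {L : ℕ} (i : Fin L) (g : Fin (L + 1) → ℂ) :
    ∏ j ∈ Iio i.succ, g j = g 0 * ∏ j ∈ Iio i, g j.succ := by
  have : Iio i.succ = insert 0 ((Iio i).map (Fin.succEmb L)) := by
    ext j
    induction j using Fin.cases <;> simp
  rw [this, prod_insert (by simp), prod_map]
  rfl

theorem defectSummand_succ (γ : ℂ) {k L : ℕ} (I : Fin k → Fin L) (u : Fin k → ℂ)
    (m : Fin (L + 1) → ℂ) :
    defectSummand γ (fun a => (I a).succ) u m =
      (∏ a, (u a - m 0 - γ / 2)) * defectSummand γ I u fun i => m i.succ := by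
  simp only [defectSummand, prod_Iio_succ, Fin.prod_Ioi_succ, mul_assoc, prod_mul_distrib]

theorem defectSummand_cons (γ : ℂ) {k L : ℕ} (I : Fin k → Fin L) (u : Fin (k + 1) → ℂ)
    (m : Fin (L + 1) → ℂ) :
    defectSummand γ (Fin.cons 0 fun a => (I a).succ) u m =
      (∏ i : Fin L, (u 0 - m i.succ + γ / 2)) *
        (∏ a : Fin k, ((u a.succ - (m 0 + γ / 2)) * exch γ (u 0) (u a.succ))) *
          defectSummand γ I (fun a => u a.succ) fun i => m i.succ := by
  have h0 : Iio (0 : Fin (L + 1)) = ∅ := by ext; simp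
  simp only [defectSummand, Fin.prod_univ_succ, Fin.cons_zero, Fin.cons_succ, prod_Iio_succ,
    Fin.prod_Ioi_succ, Fin.prod_Ioi_zero, prod_mul_distrib, h0, prod_empty, exch, sub_add_eq_sub_sub]
  ring

theorem orbifoldDefect_succ (γ : ℂ) {k L : ℕ} (I : Fin k → Fin L) (u : Fin k → ℂ)
    (m : Fin (L + 1) → ℂ) :
    orbifoldDefect γ (fun a => (I a).succ) u m =
      (∏ a, (u a - m 0 - γ / 2)) * orbifoldDefect γ I u fun i => m i.succ := by
  simp only [orbifoldDefect, symmetrize, defectSummand_succ, mul_sum]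
  exact sum_congr rfl fun σ _ => by rw [Equiv.prod_comp σ fun a => u a - m 0 - γ / 2]

/-- Permutations are sorted by p = σ(0), the rapidity placed at the first site; `decomposeFin`
leaves a permutation of the other rapidities. -/
theorem orbifoldDefect_cons (γ : ℂ) {k L : ℕ} (I : Fin k → Fin L) (u : Fin (k + 1) → ℂ)
    (m : Fin (L + 1) → ℂ) :
    orbifoldDefect γ (Fin.cons 0 fun a => (I a).succ) u m =
      ∑ p, (∏ i : Fin L, (u p - m i.succ + γ / 2)) *
        (∏ a : Fin k, ((u (Equiv.swap 0 p a.succ) - (m 0 + γ / 2)) *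
          exch γ (u p) (u (Equiv.swap 0 p a.succ)))) *
            orbifoldDefect γ I (fun a => u (Equiv.swap 0 p a.succ)) fun i => m i.succ := by
  simp only [orbifoldDefect, symmetrize, defectSummand_cons]
  rw [← Equiv.sum_comp Equiv.Perm.decomposeFin.symm, Fintype.sum_prod_type]
  refine sum_congr rfl fun p _ => ?_
  rw [mul_sum]
  refine sum_congr rfl fun e _ => ?_
  simp only [Equiv.Perm.decomposeFin_symm_apply_zero, Equiv.Perm.decomposeFin_symm_apply_succ]
  rw [Equiv.prod_comp e fun a => (u (Equiv.swap 0 p a.succ) - (m 0 + γ / 2)) *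
    exch γ (u p) (u (Equiv.swap 0 p a.succ))]

theorem image_swap_succ {k : ℕ} (u : Fin (k + 1) → ℂ) (hu : Function.Injective u)
    (p : Fin (k + 1)) :
    univ.image (fun a : Fin k => u (Equiv.swap 0 p a.succ)) = (univ.image u).erase (u p) := by
  ext z
  simp only [mem_image, mem_univ, true_and, mem_erase]
  constructor
  · rintro ⟨a, rfl⟩
    refine ⟨fun h => ?_, _, rfl⟩
    have := hu h
    rw [Equiv.swap_apply_eq_iff, Equiv.swap_apply_right] at this
    exact Fin.succ_ne_zero a this
  · rintro ⟨h, b, rfl⟩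
    have hb : Equiv.swap 0 p b ≠ 0 := by
      rw [Ne, Equiv.swap_apply_eq_iff, Equiv.swap_apply_left]
      exact fun h' => h (h' ▸ rfl)
    exact ⟨(Equiv.swap 0 p b).pred hb, by simp⟩

theorem pow_mul_defectSum (γ : ℂ) {k L : ℕ} (u : Fin k → ℂ) (m : Fin L → ℂ)
    (hu : Function.Injective u) :
    γ ^ k * defectSum γ u m =
      partitionSum γ (fun z => ∏ i, (z - m i - γ / 2)) (fun z => ∏ i, (z - m i + γ / 2))
        (univ.image u) := by
  classical
  rw [defectSum_eq_sum_strictMono]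
  induction L generalizing k with
  | zero =>
    cases k with
    | zero => simp [orbifoldDefect, symmetrize, defectSummand, Subsingleton.strictMono]
    | succ k =>
      have : IsEmpty (Fin (k + 1) → Fin 0) := ⟨fun f => (f 0).elim0⟩
      simp [partitionSum_one γ _ (univ_nonempty.image u)]
  | succ L ih =>
    cases k with
    | zero => simp [orbifoldDefect, symmetrize, defectSummand, Subsingleton.strictMono]
    | succ k =>
      simp only [Fin.prod_univ_succ]
      -- The shift by γ/2 turns the column factors x - m and x - m + γ into the symmetric pair u -
      -- m_0 ∓ γ/2.
      have hcol := partitionSum_column γ (m 0 + γ / 2) (fun z => ∏ i : Fin L, (z - m i.succ - γ / 2))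
        (fun z => ∏ i : Fin L, (z - m i.succ + γ / 2)) (univ.image u)
      have e1 : ∀ z : ℂ, z - (m 0 + γ / 2) = z - m 0 - γ / 2 := fun z => by ring
      have e2 : ∀ z : ℂ, z - m 0 - γ / 2 + γ = z - m 0 + γ / 2 := fun z => by ring
      simp only [e1, e2] at hcol
      rw [hcol, sum_strictMono_succ, ← ih u _ hu, mul_add]
      congr 1
      · simp only [orbifoldDefect_succ]
        rw [← mul_sum, prod_image hu.injOn]
        ring
      · simp only [orbifoldDefect_cons]
        rw [sum_comm, sum_image hu.injOn, pow_succ', mul_assoc]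
        congr 1
        rw [mul_sum]
        refine sum_congr rfl fun p _ => ?_
        have hu' : Function.Injective fun a : Fin k => u (Equiv.swap 0 p a.succ) :=
          hu.comp ((Equiv.injective _).comp (Fin.succ_injective _))
        rw [← image_swap_succ u hu, ← ih _ _ hu', prod_image hu'.injOn, ← mul_sum]
        simp only [e1]
        ring

/-! ### Multilinear expansion of determinants and the k × k formula -/

/-- Shifting the nodes in s by γ changes only the differences between s and its complement, each by
an exchange factor. -/
theorem prod_pairs_ite (γ c : ℂ) {k : ℕ} (w : Fin k → ℂ) (hw : Function.Injective w)
    (s : Finset (Fin k)) :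
    ∏ a, ∏ b ∈ Ioi a, ((w b + c + if b ∈ s then γ else 0) - (w a + c + if a ∈ s then γ else 0)) =
      (∏ a, ∏ b ∈ Ioi a, (w b - w a)) * ∏ a ∈ sᶜ, ∏ b ∈ s, exch γ (w a) (w b) := by
  let g : Fin k → Fin k → ℂ := fun a b => if a ∉ s ∧ b ∈ s then exch γ (w a) (w b) else 1
  have hg : ∏ a ∈ sᶜ, ∏ b ∈ s, exch γ (w a) (w b) = ∏ a, ∏ b ∈ Ioi a, g a b * g b a := by
    rw [prod_prod_Ioi_mul_eq_prod_prod_off_diag fun x y => g y x]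
    rw [← prod_subset (subset_univ sᶜ)]
    · refine prod_congr rfl fun a ha => ?_
      have ha : a ∉ s := by simpa using ha
      refine (prod_congr rfl fun b hb => ?_).trans (prod_subset (f := g a) ?_ ?_)
      · simp [g, ha, hb]
      · intro b hb
        simp only [mem_compl, mem_singleton]
        rintro rfl
        exact ha hb
      · intro b _ hb
        simp [g, hb]
    · intro a _ ha
      have ha : a ∈ s := by simpa using ha
      exact prod_eq_one fun b _ => by simp [g, ha]
  rw [hg, ← prod_mul_distrib]
  refine prod_congr rfl fun a _ => ?_
  rw [← prod_mul_distrib]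
  refine prod_congr rfl fun b hb => ?_
  have hab : w a ≠ w b := hw.ne (mem_Ioi.1 hb).ne
  have h1 : w a - w b ≠ 0 := sub_ne_zero.2 hab
  have h2 : w b - w a ≠ 0 := sub_ne_zero.2 hab.symm
  by_cases ha : a ∈ s <;> by_cases hb : b ∈ s <;> simp [g, ha, hb, exch]
  all_goals field_simp
  all_goals ring_nf

theorem det_eq_partitionSum (γ c : ℂ) (d α : ℂ → ℂ) {k : ℕ} (w : Fin k → ℂ)
    (hw : Function.Injective w) :
    (Matrix.of fun a b : Fin k =>
        α (w a) * (w a + c) ^ (b : ℕ) - d (w a) * (w a + c + γ) ^ (b : ℕ)).det =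
      (∏ a, ∏ b ∈ Ioi a, (w b - w a)) * partitionSum γ d α (univ.image w) := by
  let A : Fin k → Fin k → ℂ := fun a b => α (w a) * (w a + c) ^ (b : ℕ)
  let B : Fin k → Fin k → ℂ := fun a b => -d (w a) * (w a + c + γ) ^ (b : ℕ)
  have h : (Matrix.of fun a b : Fin k =>
      α (w a) * (w a + c) ^ (b : ℕ) - d (w a) * (w a + c + γ) ^ (b : ℕ)).det =
      Matrix.detRowAlternating (B + A) := by
    change Matrix.det _ = Matrix.det _
    congr 1
    ext a b
    simp only [Matrix.of_apply, A, B, Pi.add_apply]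
    ring
  rw [h, AlternatingMap.map_add_univ, partitionSum, mul_sum]
  refine sum_bij (fun s _ => s.image w) ?_ ?_ ?_ ?_
  · intro s _
    exact mem_powerset.2 (image_subset_image (subset_univ s))
  · intro s _ t _ h
    exact image_injective hw h
  · intro T hT
    obtain ⟨s, -, rfl⟩ := subset_image_iff.1 (mem_powerset.1 hT)
    exact ⟨s, mem_univ _, rfl⟩
  · intro s _
    rw [← image_sdiff _ _ hw, ← compl_eq_univ_sdiff]
    simp only [prod_image hw.injOn]
    have hs : s.piecewise B A = Matrix.of fun a b =>
        (if a ∈ s then -d (w a) else α (w a)) *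
          Matrix.vandermonde (fun a => w a + c + if a ∈ s then γ else 0) a b := by
      ext a b
      by_cases ha : a ∈ s <;> simp [A, B, ha, Matrix.vandermonde_apply]
    change Matrix.det (s.piecewise B A) = _
    rw [hs, Matrix.det_mul_column, Matrix.det_vandermonde, prod_pairs_ite γ c w hw, prod_ite]
    have e1 : univ.filter (· ∈ s) = s := by simp
    have e2 : univ.filter (· ∉ s) = sᶜ := by ext; simp
    rw [e1, e2]
    ring

theorem defectSum_eq_kostov (γ : ℂ) {k L : ℕ} (u : Fin k → ℂ) (m : Fin L → ℂ)
    (hu : Function.Injective u) (hγ : γ ≠ 0) (hm : ∀ a i, u a - m i + γ / 2 ≠ 0) :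
    defectSum γ u m = 1 / (-γ) ^ k *
      ((∏ a, ∏ i, (u a - m i + γ / 2)) / (∏ a, ∏ b ∈ Ioi a, (u b - u a)) *
        (kostovMatrix γ u m).det) := by
  have hV : ∏ a, ∏ b ∈ Ioi a, (u b - u a) ≠ 0 := prod_ne_zero_iff.2 fun a _ =>
    prod_ne_zero_iff.2 fun b hb => sub_ne_zero.2 (hu.ne (mem_Ioi.1 hb).ne')
  -- With c = -γ the shifted node is u itself; pulling -∏ (u - m_i + γ/2) out of each row leaves
  -- `kostovMatrix`.
  have h := det_eq_partitionSum γ (-γ) (fun z => ∏ i, (z - m i - γ / 2))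
    (fun z => ∏ i, (z - m i + γ / 2)) u hu
  rw [← pow_mul_defectSum γ u m hu] at h
  have hK : (Matrix.of fun a b : Fin k => (∏ i, (u a - m i + γ / 2)) * (u a + -γ) ^ (b : ℕ) -
      (∏ i, (u a - m i - γ / 2)) * (u a + -γ + γ) ^ (b : ℕ)) =
      Matrix.of fun a b => -(∏ i, (u a - m i + γ / 2)) * kostovMatrix γ u m a b := by
    ext a b
    have ha : ∏ i, (u a - m i + γ / 2) ≠ 0 := prod_ne_zero_iff.2 fun i _ => hm a i
    simp only [Matrix.of_apply, kostovMatrix, prod_div_distrib, neg_add_cancel_right]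
    generalize ∏ i, (u a - m i + γ / 2) = A at *
    field_simp
    ring_nf
  rw [hK, Matrix.det_mul_column, prod_neg, card_univ, Fintype.card_fin] at h
  have hγk : (-γ) ^ k ≠ 0 := pow_ne_zero _ (neg_ne_zero.2 hγ)
  have h1 : ((-1 : ℂ) ^ k) * (-1) ^ k = 1 := by rw [← mul_pow]; simp
  rw [neg_pow] at hγk ⊢
  have hγ' := pow_ne_zero k hγ
  generalize ∏ a, ∏ i, (u a - m i + γ / 2) = A at *
  field_simp
  linear_combination (-(-1) ^ k) * h + A * (kostovMatrix γ u m).det * h1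

/-! ### The L × L determinant -/

section FodaWheeler

open Filter Topology

/-- Interpolation of X^b at the nodes m_j, evaluated at z and divided by the nodal polynomial. -/
theorem sum_lagrange_inv {L : ℕ} (m : Fin L → ℂ) (hm : Function.Injective m) (z : ℂ)
    (hz : ∀ j, z - m j ≠ 0) (b : Fin L) :
    ∑ j, 1 / (z - m j) * (m j ^ (b : ℕ) / ∏ i ∈ univ.erase j, (m j - m i)) =
      z ^ (b : ℕ) / ∏ j, (z - m j) := by
  have hdeg : (Polynomial.X ^ (b : ℕ) : Polynomial ℂ).degree < #(univ : Finset (Fin L)) := by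
    rw [Polynomial.degree_X_pow, card_univ, Fintype.card_fin]
    exact_mod_cast b.2
  have h := congrArg (Polynomial.eval z) (Lagrange.eq_interpolate hm.injOn hdeg)
  rw [Lagrange.eval_interpolate_not_at_node _ fun i _ => sub_ne_zero.1 (hz i),
    Lagrange.eval_nodal] at h
  have hQ : ∏ j, (z - m j) ≠ 0 := prod_ne_zero_iff.2 fun j _ => hz j
  rw [eq_div_iff hQ, mul_comm]
  simp only [Polynomial.eval_pow, Polynomial.eval_X, Lagrange.nodalWeight, prod_inv_distrib] at h
  rw [h]
  congr 1
  exact sum_congr rfl fun j _ => by ring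

/-- The sum is the coefficient of X^(L-1) in the interpolant of X^n, which is X^n itself. -/
theorem sum_lagrange_pow {L : ℕ} (m : Fin L → ℂ) (hm : Function.Injective m) (n : ℕ)
    (hn : n < L) :
    ∑ j, m j ^ n / ∏ i ∈ univ.erase j, (m j - m i) = if n = L - 1 then 1 else 0 := by
  have hdeg : (Polynomial.X ^ n : Polynomial ℂ).degree < #(univ : Finset (Fin L)) := by
    rw [Polynomial.degree_X_pow, card_univ, Fintype.card_fin]
    exact_mod_cast hn
  have h := Lagrange.coeff_eq_sum hm.injOn hdeg
  simp only [Polynomial.coeff_X_pow, Polynomial.eval_pow, Polynomial.eval_X, card_univ,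
    Fintype.card_fin] at h
  rw [← h]
  simp [eq_comm]

/-- The matrix `m_j^b / ∏_{i ≠ j} (m_j - m_i)`. -/
def lagrangeMatrix {L : ℕ} (m : Fin L → ℂ) : Matrix (Fin L) (Fin L) ℂ :=
  Matrix.of fun j b => m j ^ (b : ℕ) / ∏ i ∈ univ.erase j, (m j - m i)

/-- A Vandermonde matrix with rescaled rows: the denominators contain each difference in both
orientations, and the Vandermonde determinant cancels one of them. -/
theorem det_lagrangeMatrix {L : ℕ} (m : Fin L → ℂ) (hm : Function.Injective m) :
    (∏ i, ∏ j ∈ Ioi i, (m i - m j)) * (lagrangeMatrix m).det = 1 := by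
  have h : lagrangeMatrix m = Matrix.of fun j b =>
      (∏ i ∈ univ.erase j, (m j - m i))⁻¹ * Matrix.vandermonde m j b := by
    ext j b
    simp [lagrangeMatrix, Matrix.vandermonde_apply, div_eq_inv_mul]
  have h2 := prod_prod_Ioi_mul_eq_prod_prod_off_diag fun i j => m j - m i
  have h3 : ∀ i : Fin L, ({i}ᶜ : Finset (Fin L)) = univ.erase i := fun i => by ext; simp
  simp only [prod_mul_distrib, h3] at h2
  have hne : ∀ j : Fin L, ∏ i ∈ univ.erase j, (m j - m i) ≠ 0 := fun j =>
    prod_ne_zero_iff.2 fun i hi => sub_ne_zero.2 (hm.ne (ne_of_mem_erase hi).symm)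
  rw [h, Matrix.det_mul_column, Matrix.det_vandermonde, prod_inv_distrib, ← h2, ← mul_assoc,
    mul_right_comm]
  refine mul_inv_cancel₀ ?_
  rw [h2]
  exact prod_ne_zero_iff.2 fun j _ => hne j

theorem det_eq_of_lower_unitriangular {k L : ℕ} (hkL : k ≤ L) (A : Matrix (Fin L) (Fin L) ℂ)
    (h0 : ∀ r b : Fin L, k ≤ (r : ℕ) → b < r → A r b = 0)
    (h1 : ∀ r : Fin L, k ≤ (r : ℕ) → A r r = 1) :
    A.det = (Matrix.of fun a b : Fin k => A (Fin.castLE hkL a) (Fin.castLE hkL b)).det := by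
  obtain ⟨n, rfl⟩ := Nat.exists_eq_add_of_le hkL
  rw [← Matrix.det_submatrix_equiv_self finSumFinEquiv A,
    ← Matrix.fromBlocks_toBlocks (A.submatrix finSumFinEquiv finSumFinEquiv)]
  have h21 : (A.submatrix (finSumFinEquiv (m := k) (n := n)) finSumFinEquiv).toBlocks₂₁ = 0 := by
    ext i j
    simp only [Matrix.toBlocks₂₁, Matrix.of_apply, Matrix.submatrix_apply, Matrix.zero_apply,
      finSumFinEquiv_apply_left, finSumFinEquiv_apply_right]
    refine h0 _ _ (by simp) ?_
    rw [Fin.lt_def]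
    simp
    omega
  have h22 : (A.submatrix (finSumFinEquiv (m := k) (n := n)) finSumFinEquiv).toBlocks₂₂.det = 1 := by
    rw [Matrix.det_of_isUpperTriangular]
    · refine prod_eq_one fun i _ => ?_
      simp only [Matrix.toBlocks₂₂, Matrix.of_apply, Matrix.submatrix_apply,
        finSumFinEquiv_apply_right]
      exact h1 _ (by simp)
    · intro i j hij
      simp only [Matrix.toBlocks₂₂, Matrix.of_apply, Matrix.submatrix_apply,
        finSumFinEquiv_apply_right]
      refine h0 _ _ (by simp) ?_
      rw [Fin.lt_def] at *
      simpa using hij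
  rw [h21, Matrix.det_fromBlocks_zero₂₁, h22, mul_one]
  rfl

/-- Multiplication by `lagrangeMatrix` makes the monomial rows zero left of the diagonal and 1 on
it, so only the upper left k × k block counts. Partial fractions, which divide by γ, and
`sum_lagrange_inv` at u ∓ γ/2 bring that block to the form of `det_eq_partitionSum` with c = -γ/2.
-/
theorem defectSum_eq_fodaWheeler_of_ne_zero (γ : ℂ) {k L : ℕ} (hkL : k ≤ L) (u : Fin k → ℂ)
    (m : Fin L → ℂ) (hu : Function.Injective u) (hγ : γ ≠ 0) (hm : Function.Injective m)
    (h1 : ∀ a i, u a - m i - γ / 2 ≠ 0) (h2 : ∀ a i, u a - m i + γ / 2 ≠ 0) :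
    defectSum γ u m =
      (∏ a, ∏ i, ((u a - m i - γ / 2) * (u a - m i + γ / 2))) /
          ((∏ a, ∏ b ∈ Ioi a, (u b - u a)) * ∏ i, ∏ j ∈ Ioi i, (m i - m j)) *
        (fodaWheelerMatrix γ u m).det := by
  have hV : ∏ a, ∏ b ∈ Ioi a, (u b - u a) ≠ 0 := prod_ne_zero_iff.2 fun a _ =>
    prod_ne_zero_iff.2 fun b hb => sub_ne_zero.2 (hu.ne (mem_Ioi.1 hb).ne')
  have hM := det_lagrangeMatrix m hm
  have hM0 : ∏ i, ∏ j ∈ Ioi i, (m i - m j) ≠ 0 := left_ne_zero_of_mul_eq_one hM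
  have hFN : ∀ r b : Fin L, k ≤ (r : ℕ) → (fodaWheelerMatrix γ u m * lagrangeMatrix m) r b =
      ∑ j, m j ^ (L - 1 - (r : ℕ) + b) / ∏ i ∈ univ.erase j, (m j - m i) := by
    intro r b hr
    rw [Matrix.mul_apply]
    refine sum_congr rfl fun j _ => ?_
    simp only [fodaWheelerMatrix, lagrangeMatrix, Matrix.of_apply, hr.not_gt, dite_false]
    rw [pow_add, mul_div_assoc]
  have hdet : (fodaWheelerMatrix γ u m * lagrangeMatrix m).det =
      (Matrix.of fun a b : Fin k =>
        (γ * ∏ i, ((u a - m i - γ / 2) * (u a - m i + γ / 2)))⁻¹ *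
        (Matrix.of fun a b : Fin k => (∏ i, (u a - m i + γ / 2)) * (u a + -(γ / 2)) ^ (b : ℕ) -
          (∏ i, (u a - m i - γ / 2)) * (u a + -(γ / 2) + γ) ^ (b : ℕ)) a b).det := by
    rw [det_eq_of_lower_unitriangular hkL]
    · congr 1
      ext a b
      have hd : ∏ i, (u a - m i - γ / 2) ≠ 0 := prod_ne_zero_iff.2 fun i _ => h1 a i
      have hα : ∏ i, (u a - m i + γ / 2) ≠ 0 := prod_ne_zero_iff.2 fun i _ => h2 a i
      have s1 := sum_lagrange_inv m hm (u a + -(γ / 2))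
        (fun j => by convert h1 a j using 1; ring) (Fin.castLE hkL b)
      have s2 := sum_lagrange_inv m hm (u a + -(γ / 2) + γ)
        (fun j => by convert h2 a j using 1; ring) (Fin.castLE hkL b)
      have e1 : ∀ j, u a + -(γ / 2) - m j = u a - m j - γ / 2 := fun j => by ring
      have e2 : ∀ j, u a + -(γ / 2) + γ - m j = u a - m j + γ / 2 := fun j => by ring
      simp only [e1, e2, Fin.val_castLE] at s1 s2
      have hF : (fodaWheelerMatrix γ u m * lagrangeMatrix m) (Fin.castLE hkL a) (Fin.castLE hkL b) =
          γ⁻¹ * ((u a + -(γ / 2)) ^ (b : ℕ) / ∏ i, (u a - m i - γ / 2) -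
            (u a + -(γ / 2) + γ) ^ (b : ℕ) / ∏ i, (u a - m i + γ / 2)) := by
        rw [← s1, ← s2, ← sum_sub_distrib, mul_sum, Matrix.mul_apply]
        refine sum_congr rfl fun j _ => ?_
        have := h1 a j
        have := h2 a j
        simp only [fodaWheelerMatrix, lagrangeMatrix, Matrix.of_apply, Fin.val_castLE, a.2,
          dite_true, Fin.eta, ← sub_mul, ← mul_assoc]
        congr 1
        rw [div_sub_div _ _ (h1 a j) (h2 a j), ← mul_div_assoc]
        congr 1
        field_simp
        ring
      simp only [Matrix.of_apply, hF, prod_mul_distrib]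
      generalize ∏ i, (u a - m i + γ / 2) = A at *
      generalize ∏ i, (u a - m i - γ / 2) = D at *
      field_simp
    all_goals intro r
    · intro b hr hb
      have hb' := Fin.lt_def.1 hb
      have hrL := r.2
      rw [hFN r b hr, sum_lagrange_pow m hm _ (by omega), if_neg (by omega)]
    · intro hr
      have hrL := r.2
      rw [hFN r r hr, sum_lagrange_pow m hm _ (by omega), if_pos (by omega)]
  have h := det_eq_partitionSum γ (-(γ / 2)) (fun z => ∏ i, (z - m i - γ / 2))
    (fun z => ∏ i, (z - m i + γ / 2)) u hu
  rw [Matrix.det_mul_column, h, ← pow_mul_defectSum γ u m hu, Matrix.det_mul, prod_inv_distrib,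
    prod_mul_distrib, prod_const, card_univ, Fintype.card_fin] at hdet
  have hP : ∏ a, ∏ i, ((u a - m i - γ / 2) * (u a - m i + γ / 2)) ≠ 0 :=
    prod_ne_zero_iff.2 fun a _ => prod_ne_zero_iff.2 fun i _ => mul_ne_zero (h1 a i) (h2 a i)
  have hγ' := pow_ne_zero k hγ
  generalize ∏ a, ∏ i, ((u a - m i - γ / 2) * (u a - m i + γ / 2)) = P at *
  generalize (lagrangeMatrix m).det = N at *
  generalize ∏ i, ∏ j ∈ Ioi i, (m i - m j) = M at *
  field_simp at hdet ⊢
  linear_combination (-M) * hdet + P * (fodaWheelerMatrix γ u m).det * hM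

/-- At γ = 0, with u and m fixed, both sides are continuous in γ and the nonvanishing conditions
persist nearby. -/
theorem defectSum_eq_fodaWheeler (γ : ℂ) {k L : ℕ} (hkL : k ≤ L) (u : Fin k → ℂ)
    (m : Fin L → ℂ) (hu : Function.Injective u) (hm : Function.Injective m)
    (h1 : ∀ a i, u a - m i - γ / 2 ≠ 0) (h2 : ∀ a i, u a - m i + γ / 2 ≠ 0) :
    defectSum γ u m =
      (∏ a, ∏ i, ((u a - m i - γ / 2) * (u a - m i + γ / 2))) /
          ((∏ a, ∏ b ∈ Ioi a, (u b - u a)) * ∏ i, ∏ j ∈ Ioi i, (m i - m j)) *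
        (fodaWheelerMatrix γ u m).det := by
  rcases ne_or_eq γ 0 with hγ | rfl
  · exact defectSum_eq_fodaWheeler_of_ne_zero γ hkL u m hu hγ hm h1 h2
  have hL : Tendsto (fun γ => defectSum γ u m) (𝓝[≠] 0) (𝓝 (defectSum 0 u m)) := by
    refine (Continuous.tendsto ?_ 0).mono_left nhdsWithin_le_nhds
    unfold defectSum orbifoldDefect symmetrize defectSummand
    fun_prop
  have hdet : ContinuousAt (fun γ => (fodaWheelerMatrix γ u m).det) 0 := by
    refine (Continuous.matrix_det continuous_id).continuousAt.comp ?_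
    refine continuousAt_pi.2 fun r => continuousAt_pi.2 fun j => ?_
    simp only [Matrix.of_apply]
    split_ifs with h
    · refine ContinuousAt.div (by fun_prop) (by fun_prop) ?_
      exact mul_ne_zero (h1 _ _) (h2 _ _)
    · exact continuousAt_const
  have hR : ContinuousAt (fun γ => (∏ a, ∏ i, ((u a - m i - γ / 2) * (u a - m i + γ / 2))) /
          ((∏ a, ∏ b ∈ Ioi a, (u b - u a)) * ∏ i, ∏ j ∈ Ioi i, (m i - m j)) *
        (fodaWheelerMatrix γ u m).det) 0 := by
    refine ContinuousAt.mul (ContinuousAt.div_const ?_ _) hdet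
    fun_prop
  refine tendsto_nhds_unique (hL.congr' ?_) (hR.tendsto.mono_left nhdsWithin_le_nhds)
  have ev1 : ∀ a i, ∀ᶠ γ : ℂ in 𝓝 0, u a - m i - γ / 2 ≠ 0 := fun a i =>
    ContinuousAt.eventually_ne (by fun_prop) (h1 a i)
  have ev2 : ∀ a i, ∀ᶠ γ : ℂ in 𝓝 0, u a - m i + γ / 2 ≠ 0 := fun a i =>
    ContinuousAt.eventually_ne (by fun_prop) (h2 a i)
  simp only [← eventually_all] at ev1 ev2
  filter_upwards [nhdsWithin_le_nhds ev1, nhdsWithin_le_nhds ev2, self_mem_nhdsWithin]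
    with γ g1 g2 g3
  exact defectSum_eq_fodaWheeler_of_ne_zero γ hkL u m hu g3 hm g1 g2

end FodaWheeler

/-! ### Yangian relations and the algebraic Bethe ansatz -/

/-- The Yangian relations `(x - y) [T_ij(x), T_kl(y)] = γ (T_kj(x) T_il(y) - T_kj(y) T_il(x))`. -/
def IsYangian {R : Type*} [Ring R] [Algebra ℂ R] (γ : ℂ) (T : ℂ → Fin 2 → Fin 2 → R) : Prop :=
  ∀ x y i j k l, (x - y) • (T x i j * T y k l) - γ • (T x k j * T y i l) =
    (x - y) • (T y k l * T x i j) - γ • (T y k j * T x i l)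

namespace IsYangian

section Algebra

variable {R : Type*} [Ring R] [Algebra ℂ R] {γ : ℂ} {T : ℂ → Fin 2 → Fin 2 → R}

theorem map {R' : Type*} [Ring R'] [Algebra ℂ R'] (hT : IsYangian γ T) (f : R →ₐ[ℂ] R') :
    IsYangian γ fun x i j => f (T x i j) := by
  intro x y i j k l
  simpa only [map_sub, map_smul, map_mul] using congrArg f (hT x y i j k l)

/-- The Yangian coproduct: adjoining a column preserves the relations. -/
theorem mul {A B : ℂ → Fin 2 → Fin 2 → R} (hA : IsYangian γ A) (hB : IsYangian γ B)
    (hAB : ∀ x y i j k l, Commute (A x i j) (B y k l)) :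
    IsYangian γ fun x i j => ∑ a, A x i a * B x a j := by
  intro x y i j k l
  have hc : ∀ x y i j k l a b, A x i a * B x a j * (A y k b * B y b l) =
      A x i a * A y k b * (B x a j * B y b l) := fun x y i j k l a b =>
    (hAB y x k b a j).symm.mul_mul_mul_comm _ _
  simp only [sum_mul_sum, hc, smul_sum]
  calc _ = ∑ a, ∑ b, ((x - y) • (A x i a * A y k b) - γ • (A x k a * A y i b)) *
        (B x a j * B y b l) := by
        simp only [← sum_sub_distrib, sub_mul, smul_mul_assoc]
    _ = ∑ a, ∑ b, (x - y) • (A y k b * A x i a * (B x a j * B y b l)) -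
        ∑ a, ∑ b, γ • (A y k a * A x i b * (B x a j * B y b l)) := by
        simp only [← sum_sub_distrib, hA x y i _ k _, sub_mul, smul_mul_assoc]
    -- Exchanging the summation indices in the γ-term gives both terms the same A-factor, so the
    -- relation for B applies.
    _ = ∑ a, ∑ b, (A y k b * A x i a) *
        ((x - y) • (B x a j * B y b l) - γ • (B x b j * B y a l)) := by
        rw [sum_comm (f := fun a b => γ • (A y k a * A x i b * (B x a j * B y b l)))]
        simp only [← sum_sub_distrib, mul_sub, mul_smul_comm]
    _ = ∑ a, ∑ b, (x - y) • (A y k b * A x i a * (B y b l * B x a j)) -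
        ∑ a, ∑ b, γ • (A y k b * A x i a * (B y b j * B x a l)) := by
        simp only [← sum_sub_distrib, hB x y _ j _ l, mul_sub, mul_smul_comm]
    _ = _ := by
        rw [sum_comm, sum_comm (f := fun a b => γ • (A y k b * A x i a * (B y b j * B x a l)))]

/-- The relation gives (x - y - γ)[B(x), B(y)] = 0. If this factor vanishes, exchange x and y; both
factors vanish only when x = y. -/
theorem commute_zero_one (hT : IsYangian γ T) (x y : ℂ) : Commute (T x 0 1) (T y 0 1) := by
  have h : ∀ x y, (x - y - γ) • (T x 0 1 * T y 0 1 - T y 0 1 * T x 0 1) = 0 := by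
    intro x y
    have := hT x y 0 1 0 1
    rw [← sub_smul, ← sub_smul] at this
    rw [smul_sub, this, sub_self]
  by_cases h1 : x - y - γ = 0
  · by_cases h2 : y - x - γ = 0
    · have : x = y := by linear_combination h1 / 2 - h2 / 2
      rw [this]
    · exact (sub_eq_zero.1 ((smul_eq_zero.1 (h y x)).resolve_left h2)).symm
  · exact sub_eq_zero.1 ((smul_eq_zero.1 (h x y)).resolve_left h1)

theorem zero_zero_mul_zero_one (hT : IsYangian γ T) {x y : ℂ} (hxy : x ≠ y) :
    T y 0 0 * T x 0 1 =
      exch γ x y • (T x 0 1 * T y 0 0) + (γ / (x - y)) • (T y 0 1 * T x 0 0) := by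
  have h := hT x y 0 1 0 0
  have h0 : x - y ≠ 0 := sub_ne_zero.2 hxy
  rw [← sub_smul, eq_sub_iff_add_eq] at h
  rw [exch, div_eq_inv_mul, div_eq_inv_mul, mul_smul, mul_smul, ← smul_add, h, inv_smul_smul₀ h0]

/-- The product of the commuting operators `T_01(x)` over `x ∈ S`. -/
def creation (hT : IsYangian γ T) (S : Finset ℂ) : R :=
  S.noncommProd (fun x => T x 0 1) fun x _ y _ _ => hT.commute_zero_one x y

theorem creation_empty (hT : IsYangian γ T) : hT.creation ∅ = 1 :=
  noncommProd_empty _ _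

theorem creation_insert (hT : IsYangian γ T) {x : ℂ} {S : Finset ℂ} (hx : x ∉ S) :
    hT.creation (insert x S) = T x 0 1 * hT.creation S :=
  noncommProd_insert_of_notMem _ _ _ _ hx

theorem creation_insert' (hT : IsYangian γ T) {x : ℂ} {S : Finset ℂ} (hx : x ∉ S) :
    hT.creation (insert x S) = hT.creation S * T x 0 1 :=
  noncommProd_insert_of_notMem' _ _ _ _ hx

/-- The wanted and unwanted terms of the Bethe ansatz. Moving A(y) past B(z) leaves A(y) or A(z) in
front of the remaining product, so induction is used at both y and z. -/
theorem zero_zero_mul_creation (hT : IsYangian γ T) {d : ℂ → ℂ} {E : R}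
    (hE : ∀ y, T y 0 0 * E = d y • E) (S : Finset ℂ) :
    ∀ y ∉ S, T y 0 0 * (hT.creation S * E) =
      (d y * ∏ x ∈ S, exch γ x y) • (hT.creation S * E) +
        ∑ j ∈ S, (γ / (j - y) * d j * ∏ i ∈ S.erase j, exch γ i j) •
          (T y 0 1 * (hT.creation (S.erase j) * E)) := by
  induction S using Finset.induction_on with
  | empty => simp [creation_empty, hE]
  | insert z S hz ih =>
    intro y hy
    rw [mem_insert, not_or] at hy
    have hyz : z ≠ y := Ne.symm hy.1
    rw [hT.creation_insert hz, mul_assoc, ← mul_assoc, hT.zero_zero_mul_zero_one hyz, add_mul,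
      smul_mul_assoc, smul_mul_assoc, mul_assoc, mul_assoc, ih y hy.2, ih z hz, sum_insert hz,
      erase_insert hz, prod_insert hz, mul_add, mul_add, smul_add, smul_add, mul_sum, mul_sum,
      smul_sum, smul_sum]
    simp only [mul_smul_comm, smul_smul]
    rw [add_add_add_comm, ← sum_add_distrib, ← add_assoc]
    congr 1
    · congr 2 <;> ring
    · refine sum_congr rfl fun j hj => ?_
      have hjz : z ≠ j := fun h => hz (h ▸ hj)
      have hjy : j ≠ y := fun h => hy.2 (h ▸ hj)
      have hz' : z ∉ S.erase j := fun h => hz (mem_of_mem_erase h)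
      rw [erase_insert_of_ne hjz, prod_insert hz', hT.creation_insert hz', mul_assoc (T z 0 1),
        ← mul_assoc (T z 0 1) (T y 0 1), (hT.commute_zero_one z y).eq, mul_assoc (T y 0 1),
        ← add_smul]
      congr 1
      have h1 := sub_ne_zero.2 hyz
      have h2 := sub_ne_zero.2 hjz
      have h3 := sub_ne_zero.2 hjy
      have h4 := sub_ne_zero.2 hjz.symm
      rw [exch, exch]
      -- Each unwanted term j ≠ z arises along both routes; this identity adds the two coefficients.
      have key : (z - y - γ) / (z - y) * (γ / (j - y)) + γ / (z - y) * (γ / (j - z)) =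
          γ / (j - y) * ((z - j - γ) / (z - j)) := by
        field_simp
        ring
      linear_combination (d j * ∏ i ∈ S.erase j, exch γ i j) * key

/-- Replace v(B(y)X) by α(y)v(X) - v(A(y)X) and move A(y) to E: this is the recursion
`partitionSum_insert`. -/
theorem map_creation (hT : IsYangian γ T) {d α : ℂ → ℂ} {E : R}
    (hE : ∀ y, T y 0 0 * E = d y • E) (v : R →ₗ[ℂ] ℂ)
    (hv : ∀ y X, v (T y 0 0 * X) + v (T y 0 1 * X) = α y * v X) (S : Finset ℂ) :
    v (hT.creation S * E) = partitionSum γ d α S * v E := by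
  induction h : #S using Nat.strong_induction_on generalizing S with
  | _ n ih =>
    rcases S.eq_empty_or_nonempty with rfl | ⟨y, hy⟩
    · simp [creation_empty]
    · have hlt : #(S.erase y) < n := h ▸ card_erase_lt_of_mem hy
      have hyS := notMem_erase y S
      rw [← insert_erase hy, partitionSum_insert _ _ _ _ _ hyS, hT.creation_insert hyS, mul_assoc,
        eq_sub_of_add_eq' (hv y _), hT.zero_zero_mul_creation hE _ _ hyS, map_add, map_smul, map_sum,
        ih _ hlt _ rfl, sub_mul, sum_mul, smul_eq_mul, sub_mul, sub_mul, sub_add_eq_sub_sub]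
      congr 1
      · ring
      · refine sum_congr rfl fun j hj => ?_
        have hyj : y ∉ (S.erase y).erase j := fun h => hyS (mem_of_mem_erase h)
        rw [map_smul, ← mul_assoc, ← hT.creation_insert hyj, ih _ ?_ _ rfl, smul_eq_mul, ← mul_assoc]
        exact (card_insert_le _ _).trans_lt <|
          (Nat.succ_le_of_lt (card_erase_lt_of_mem hj)).trans_lt hlt

end Algebra

end IsYangian

/-! ### The monodromy matrix and the six-vertex partition function -/

/-- The one-site monodromy matrix: the vertex weights as operators on the vertical colours. -/
def siteOperator (γ y x : ℂ) (l r : Fin 2) : Matrix (Fin 2) (Fin 2) ℂ :=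
  Matrix.of fun t b => vertexWeight γ x y l b r t

theorem isYangian_siteOperator (γ y : ℂ) : IsYangian γ (siteOperator γ y) := by
  intro x x' i j k l
  ext t b
  simp only [siteOperator, Matrix.sub_apply, Matrix.smul_apply, Matrix.mul_apply,
    Fin.sum_univ_two, Matrix.of_apply, smul_eq_mul, vertexWeight]
  fin_cases i <;> fin_cases j <;> fin_cases k <;> fin_cases l <;> fin_cases t <;> fin_cases b <;>
    simp <;> ring_nf <;> simp

/-- The monodromy matrix of a row: the sum over the colours of the horizontal bonds. -/
def monodromy (γ : ℂ) {L : ℕ} (y : Fin L → ℂ) (x : ℂ) (l r : Fin 2) :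
    Matrix (Fin L → Fin 2) (Fin L → Fin 2) ℂ :=
  Matrix.of fun t b => ∑ h : Fin (L + 1) → Fin 2 with h 0 = l ∧ h (Fin.last L) = r,
    ∏ i, vertexWeight γ x (y i) (h i.castSucc) (b i) (h i.succ) (t i)

theorem monodromy_zero (γ : ℂ) (y : Fin 0 → ℂ) (x : ℂ) (l r : Fin 2) :
    monodromy γ y x l r = (if l = r then 1 else 0 : ℂ) • 1 := by
  ext t b
  rw [Subsingleton.elim t b, monodromy, Matrix.of_apply, sum_filter,
    ← Equiv.sum_comp (Equiv.funUnique (Fin 1) (Fin 2)).symm]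
  simp [ite_and, Equiv.funUnique]

theorem monodromy_cons (γ : ℂ) {L : ℕ} (y : Fin (L + 1) → ℂ) (x : ℂ) (l r t₀ b₀ : Fin 2)
    (t b : Fin L → Fin 2) :
    monodromy γ y x l r (Fin.cons t₀ t) (Fin.cons b₀ b) =
      ∑ a, vertexWeight γ x (y 0) l b₀ a t₀ * monodromy γ (fun i => y i.succ) x a r t b := by
  simp only [monodromy, Matrix.of_apply, sum_filter, mul_sum]
  rw [← Equiv.sum_comp (Fin.consEquiv fun _ => Fin 2), Fintype.sum_prod_type, sum_comm,
    sum_comm (s := (univ : Finset (Fin 2)))]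
  refine sum_congr rfl fun h _ => ?_
  simp only [Fin.consEquiv_apply, Fin.cons_zero, ← Fin.succ_last, Fin.cons_succ,
    Fin.prod_univ_succ, Fin.castSucc_zero, ← Fin.succ_castSucc, ite_and]
  rw [sum_ite_eq' univ l]
  simp

theorem monodromy_succ (γ : ℂ) {L : ℕ} (y : Fin (L + 1) → ℂ) (x : ℂ) (l r : Fin 2) :
    monodromy γ y x l r = Matrix.reindexAlgEquiv ℂ ℂ (Fin.consEquiv fun _ => Fin 2)
      (∑ a, (siteOperator γ (y 0) x l a ⊗ₖ 1) * (1 ⊗ₖ monodromy γ (fun i => y i.succ) x a r)) := by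
  ext t b
  rw [← Fin.cons_self_tail t, ← Fin.cons_self_tail b, monodromy_cons]
  simp only [← Matrix.mul_kronecker_mul, one_mul, mul_one, Matrix.coe_reindexAlgEquiv,
    Matrix.reindex_apply, Matrix.submatrix_apply, Matrix.sum_apply, Matrix.kroneckerMap_apply]
  rfl

theorem isYangian_monodromy (γ : ℂ) {L : ℕ} (y : Fin L → ℂ) : IsYangian γ (monodromy γ y) := by
  induction L with
  | zero =>
    intro x x' i j k l
    simp only [monodromy_zero, smul_mul_smul_comm, mul_one, mul_comm]
  | succ L ih =>
    have h : IsYangian γ fun x l r => ∑ a, ((siteOperator γ (y 0) x l a ⊗ₖ 1) *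
        (1 ⊗ₖ monodromy γ (fun i => y i.succ) x a r) :
          Matrix (Fin 2 × (Fin L → Fin 2)) (Fin 2 × (Fin L → Fin 2)) ℂ) := by
      refine IsYangian.mul ?_ ?_ ?_
      · intro x x' i j k l
        have := congrArg (· ⊗ₖ (1 : Matrix (Fin L → Fin 2) (Fin L → Fin 2) ℂ))
          (isYangian_siteOperator γ (y 0) x x' i j k l)
        simpa only [sub_eq_add_neg, ← neg_smul, Matrix.add_kronecker, Matrix.smul_kronecker,
          ← Matrix.mul_kronecker_mul, one_mul] using this
      · intro x x' i j k l
        have := congrArg ((1 : Matrix (Fin 2) (Fin 2) ℂ) ⊗ₖ ·)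
          (ih (fun i => y i.succ) x x' i j k l)
        simpa only [sub_eq_add_neg, ← neg_smul, Matrix.kronecker_add, Matrix.kronecker_smul,
          ← Matrix.mul_kronecker_mul, one_mul] using this
      · intro x x' i j k l
        rw [Commute, SemiconjBy, ← Matrix.mul_kronecker_mul, ← Matrix.mul_kronecker_mul, one_mul,
          one_mul, mul_one, mul_one]
    have h' := h.map (Matrix.reindexAlgEquiv ℂ ℂ (Fin.consEquiv fun _ => Fin 2)).toAlgHom
    intro x x' i j k l
    simp only [monodromy_succ]
    exact h' x x' i j k l

/-- Freezing: colour 2 below and colour 1 on the right force colour 1 on the left and colour 2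
above, with weight x - y, at every vertex from right to left. -/
theorem monodromy_one_one (γ : ℂ) {L : ℕ} (y : Fin L → ℂ) (x : ℂ) (l : Fin 2)
    (t : Fin L → Fin 2) :
    monodromy γ y x l 0 t (fun _ => 1) =
      if l = 0 ∧ t = fun _ => 1 then ∏ i, (x - y i) else 0 := by
  induction L generalizing l with
  | zero =>
    rw [monodromy_zero]
    simp [Subsingleton.elim t fun _ => 1, Matrix.smul_apply]
  | succ L ih =>
    have e : (fun _ => 1 : Fin (L + 1) → Fin 2) = Fin.cons 1 fun _ => 1 := by
      ext i
      cases i using Fin.cases <;> rfl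
    rw [← Fin.cons_self_tail t, e, monodromy_cons]
    simp only [ih, Fin.sum_univ_two, Fin.cons_inj, Fin.prod_univ_succ, vertexWeight]
    generalize t 0 = t₀
    by_cases ht : Fin.tail t = fun _ => 1 <;> fin_cases l <;> fin_cases t₀ <;> simp [ht]

/-- Whatever colours enter a vertex, its weights sum to x - y + γ over the outgoing colours. -/
theorem sum_monodromy (γ : ℂ) {L : ℕ} (y : Fin L → ℂ) (x : ℂ) (l : Fin 2) (b : Fin L → Fin 2) :
    ∑ t, ∑ r, monodromy γ y x l r t b = ∏ i, (x - y i + γ) := by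
  induction L generalizing l with
  | zero =>
    simp [monodromy_zero, Matrix.smul_apply, Subsingleton.elim _ b]
  | succ L ih =>
    obtain ⟨b₀, b, rfl⟩ : ∃ b₀ b', b = Fin.cons b₀ b' := ⟨_, _, (Fin.cons_self_tail b).symm⟩
    rw [← Equiv.sum_comp (Fin.consEquiv fun _ => Fin 2), Fintype.sum_prod_type]
    have h : ∀ t₀ : Fin 2,
        ∑ t : Fin L → Fin 2, ∑ r, monodromy γ y x l r (Fin.cons t₀ t) (Fin.cons b₀ b) =
          ∑ a, vertexWeight γ x (y 0) l b₀ a t₀ * ∏ i : Fin L, (x - y i.succ + γ) := by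
      intro t₀
      simp only [monodromy_cons]
      rw [sum_congr rfl fun t _ => sum_comm, sum_comm]
      refine sum_congr rfl fun a _ => ?_
      rw [← ih _ a b, mul_sum]
      exact sum_congr rfl fun t _ => (mul_sum _ _ _).symm
    change ∑ t₀ : Fin 2, ∑ t : Fin L → Fin 2,
      ∑ r, monodromy γ y x l r (Fin.cons t₀ t) (Fin.cons b₀ b) = _
    rw [sum_congr rfl fun t₀ _ => h t₀, Fin.prod_univ_succ]
    simp only [← sum_mul]
    congr 1
    simp only [Fin.sum_univ_two, vertexWeight]
    fin_cases l <;> fin_cases b₀ <;> simp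
    ring

/-- A matrix product expanded over intermediate states. The bottom row acts first, so it is split
off on the right. -/
theorem sum_paths_eq {X : Type*} [Fintype X] [DecidableEq X] {γ : ℂ}
    {T : ℂ → Fin 2 → Fin 2 → Matrix X X ℂ} (hT : IsYangian γ T) {k : ℕ} (x : Fin k → ℂ)
    (hx : Function.Injective x) (b : X) :
    ∑ V : Fin (k + 1) → X with V 0 = b, ∏ a, T (x a) 0 1 (V a.succ) (V a.castSucc) =
      ∑ t, hT.creation (univ.image x) t b := by
  induction k generalizing b with
  | zero =>
    rw [sum_filter, ← Equiv.sum_comp (Equiv.funUnique (Fin 1) X).symm]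
    simp [hT.creation_empty, Equiv.funUnique, Matrix.one_apply]
  | succ k ih =>
    have hx' : Function.Injective fun a : Fin k => x a.succ := hx.comp (Fin.succ_injective _)
    have himg : univ.image x = insert (x 0) (univ.image fun a : Fin k => x a.succ) := by
      ext z
      simp [Fin.exists_fin_succ, eq_comm]
    have hnot : x 0 ∉ univ.image fun a : Fin k => x a.succ := by
      simp only [mem_image, mem_univ, true_and, not_exists]
      exact fun a h => Fin.succ_ne_zero a (hx h)
    rw [himg, hT.creation_insert' hnot]
    simp only [Matrix.mul_apply]
    rw [sum_comm]
    simp only [← sum_mul, ← ih _ hx', sum_filter]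
    rw [← Equiv.sum_comp (Fin.consEquiv fun _ => X), Fintype.sum_prod_type]
    simp only [Fin.consEquiv_apply, Fin.prod_univ_succ, Fin.cons_zero, Fin.cons_succ,
      Fin.castSucc_zero, ← Fin.succ_castSucc, sum_mul, ite_mul, zero_mul]
    rw [sum_comm, sum_comm (s := (univ : Finset X))]
    refine sum_congr rfl fun V _ => ?_
    rw [sum_ite_eq, sum_ite_eq']
    simp [mul_comm]

theorem sixVertexPDWPF_eq_sum_paths (γ : ℂ) {k L : ℕ} (x : Fin k → ℂ) (y : Fin L → ℂ) :
    sixVertexPDWPF γ x y = ∑ V : Fin (k + 1) → Fin L → Fin 2 with V 0 = fun _ => 1,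
      ∏ a, monodromy γ y (x a) 0 1 (V a.succ) (V a.castSucc) := by
  classical
  simp only [sixVertexPDWPF, monodromy, Matrix.of_apply, prod_univ_sum]
  rw [sum_filter, sum_filter, Fintype.sum_prod_type_right]
  refine sum_congr rfl fun V _ => ?_
  have : Fintype.piFinset (fun _ : Fin k =>
      univ.filter fun h : Fin (L + 1) → Fin 2 => h 0 = 0 ∧ h (Fin.last L) = 1) =
      univ.filter fun H : Fin k → Fin (L + 1) → Fin 2 => ∀ a, H a 0 = 0 ∧ H a (Fin.last L) = 1 := by
    ext H
    simp
  rw [this, sum_filter]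
  by_cases hV : V 0 = fun _ => 1
  · simp [IsPartialDomainWall, hV, forall_and]
  · have : ¬∀ i, V 0 i = 1 := fun h => hV (funext h)
    simp [IsPartialDomainWall, hV, this]

theorem sixVertexPDWPF_eq_partitionSum (γ : ℂ) {k L : ℕ} (x : Fin k → ℂ) (y : Fin L → ℂ)
    (hx : Function.Injective x) :
    sixVertexPDWPF γ x y =
      partitionSum γ (fun z => ∏ i, (z - y i)) (fun z => ∏ i, (z - y i + γ)) (univ.image x) := by
  have hT := isYangian_monodromy γ y
  let s : Fin L → Fin 2 := fun _ => 1
  -- The projector onto the pseudo-vacuum s lets the vacuum vector live in the matrix algebra; v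
  -- then sums column s over the free top colours.
  let E : Matrix (Fin L → Fin 2) (Fin L → Fin 2) ℂ := Matrix.single s s 1
  let v : Matrix (Fin L → Fin 2) (Fin L → Fin 2) ℂ →ₗ[ℂ] ℂ :=
    { toFun := fun X => ∑ t, X t s
      map_add' := fun X Y => by simp [sum_add_distrib]
      map_smul' := fun c X => by simp [mul_sum] }
  have hvE : ∀ X, v (X * E) = ∑ t, X t s := fun X =>
    sum_congr rfl fun t _ => by simp [E]
  have hE : ∀ z, monodromy γ y z 0 0 * E = (∏ i, (z - y i)) • E := by
    intro z
    ext t b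
    by_cases hb : b = s
    · subst hb
      simp only [E, Matrix.mul_single_apply_same, mul_one, Matrix.smul_apply, Matrix.single_apply,
        and_true, smul_eq_mul]
      rw [monodromy_one_one]
      simp [s, eq_comm]
    · simp [E, Ne.symm hb, hb]
  have hv : ∀ z X, v (monodromy γ y z 0 0 * X) + v (monodromy γ y z 0 1 * X) =
      (∏ i, (z - y i + γ)) * v X := by
    intro z X
    change ∑ t, (monodromy γ y z 0 0 * X) t s + ∑ t, (monodromy γ y z 0 1 * X) t s =
      _ * ∑ t, X t s
    simp only [Matrix.mul_apply]
    rw [sum_comm, sum_comm (f := fun t c => monodromy γ y z 0 1 t c * X c s), ← sum_add_distrib,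
      mul_sum]
    refine sum_congr rfl fun c _ => ?_
    rw [← sum_monodromy γ y z 0 c, ← sum_mul, ← sum_mul, ← add_mul, ← sum_add_distrib]
    simp only [Fin.sum_univ_two]
  have h := hT.map_creation hE v hv (univ.image x)
  rw [hvE, ← one_mul E, hvE] at h
  rw [sixVertexPDWPF_eq_sum_paths, sum_paths_eq hT x hx, h]
  simp [Matrix.one_apply]

theorem sixVertexPDWPF_eq_defectSum (γ : ℂ) {k L : ℕ} (u : Fin k → ℂ) (m : Fin L → ℂ)
    (hu : Function.Injective u) :
    sixVertexPDWPF γ (fun a => u a - γ / 2) m = γ ^ k * defectSum γ u m := by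
  -- The weights depend only on x - y, so the shift passes from the rapidities to the
  -- inhomogeneities.
  have h : sixVertexPDWPF γ (fun a => u a - γ / 2) m =
      sixVertexPDWPF γ u fun i => m i + γ / 2 := by
    have e : ∀ a i, u a - γ / 2 - m i = u a - (m i + γ / 2) := fun a i => by ring
    simp only [sixVertexPDWPF, vertexWeight, e]
  rw [h, sixVertexPDWPF_eq_partitionSum γ u _ hu, pow_mul_defectSum γ u m hu]
  have e1 : ∀ z i, z - (m i + γ / 2) = z - m i - γ / 2 := fun z i => by ring
  have e2 : ∀ z i, z - m i - γ / 2 + γ = z - m i + γ / 2 := fun z i => by ring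
  simp only [e1, e2]

end

end PartialDWPF

theorem mainTheorem3 (γ : ℂ) {k L : ℕ} (hkL : k ≤ L) (u : Fin k → ℂ) (m : Fin L → ℂ)
    (hu : Function.Injective u) :
    PartialDWPF.sixVertexPDWPF γ (fun a => u a - γ / 2) m =
        γ ^ k * PartialDWPF.defectSum γ u m ∧
      (Function.Injective m →
        (∀ a i, u a - m i - γ / 2 ≠ 0) → (∀ a i, u a - m i + γ / 2 ≠ 0) →
        PartialDWPF.defectSum γ u m =
          (∏ a, ∏ i, ((u a - m i - γ / 2) * (u a - m i + γ / 2))) /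
              ((∏ a, ∏ b ∈ Finset.Ioi a, (u b - u a)) *
                ∏ i, ∏ j ∈ Finset.Ioi i, (m i - m j)) *
            (PartialDWPF.fodaWheelerMatrix γ u m).det) ∧
      (γ ≠ 0 → (∀ a i, u a - m i + γ / 2 ≠ 0) →
        PartialDWPF.defectSum γ u m =
          1 / (-γ) ^ k *
            ((∏ a, ∏ i, (u a - m i + γ / 2)) / (∏ a, ∏ b ∈ Finset.Ioi a, (u b - u a)) *
              (PartialDWPF.kostovMatrix γ u m).det)) :=
  ⟨PartialDWPF.sixVertexPDWPF_eq_defectSum γ u m hu,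
    PartialDWPF.defectSum_eq_fodaWheeler γ hkL u m hu,
    PartialDWPF.defectSum_eq_kostov γ u m hu⟩
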